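/- Let $\Omega\subseteq\mathbb{R}^d$ be an open convex set, $T\in\mathbb{R}$, and $\Omega_T:=\Omega\times(0,T)$. Let $f:\Omega_T\to\mathbb{R}$ satisfy: (F1) $f\in W^{1,1}_{\mathrm{loc}}(\Omega_T)$, and $f$ is positive and continuous on $\Omega_T$; (F2) for all $0<t_1<t_2<T$ and every continuously differentiable curve $x:[t_1,t_2]\to\Omega$, the function $t\mapsto f(x(t),t)$ is absolutely continuous on $[t_1,t_2]$; (F3) for all $0<t_1<t_2<T$ and every absolutely continuous curve $x:[t_1,t_2]\to\Omega$, the set of those points $(x(t),t)$, $t\in[t_1,t_2]$, at which $f$ has no classical total derivative has one-dimensional Hausdorff measure zero. Let $C>0$, $p>1$, $r\in\mathbb{R}$ and $a\in L^1_{\mathrm{loc}}(0,T)$, and suppose that $$\frac{\partial f}{\partial t}+a f\le-\frac{C|\nabla f|^p}{f^r}\qquad\text{a.e. in }\Omega_T,\tag{1}$$ where $\partial f/\partial t$ and $\nabla f$ are the weak time derivative and the weak spatial gradient of $f$. Let $A$ be an antiderivative of $a$ on $(0,T)$, that is, $A(t)-A(s)=\int_s^t a(\tau)\,d\tau$ for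 all $s,t\in(0,T)$, and put $$q:=\frac{p}{p-1},\qquad m:=\frac{r}{p-1}-1,\qquad \xi:=\frac1q\Big(\frac1{pC}\Big)^{q-1},\qquad I:=\int_{t_1}^{t_2}e^{m(p-1)A(t)}\,dt .$$ Then for all $x_1,x_2\in\Omega$ and $0<t_1<t_2<T$: (i) if $r=p-1$, then $$f(x_2,t_2)\le\frac{e^{A(t_1)}}{e^{A(t_2)}}\,f(x_1,t_1)\,e^{\frac{\xi|x_2-x_1|^q}{(t_2-t_1)^{q-1}}};$$ (ii) if $r>p-1$, then $$[f(x_2,t_2)]^{-m}\ge\frac{e^{mA(t_2)}}{e^{mA(t_1)}}\Big([f(x_1,t_1)]^{-m}-m\xi|x_2-x_1|^qI^{1-q}e^{mA(t_1)}\Big),$$ and if the quantity in the large parentheses is positive, then $$f(x_2,t_2)\le\frac{e^{A(t_1)}}{e^{A(t_2)}}\,f(x_1,t_1)\Big(1-m\xi|x_2-x_1|^qI^{1-q}[f(x_1,t_1)]^me^{mA(t_1)}\Big)^{-\frac1m};$$ (iii) if $r<p-1$, then $$f(x_2,t_2)\le\frac{e^{A(t_1)}}{e^{A(t_2)}}\,f(x_1,t_1)\Big(1+\frac{|m|\,\xi\,|x_2-x_1|^qI^{1-q}}{[f(x_1,t_1)]^{|m|}e^{|m|A(t_1)}}\Big)^{\frac1{|m|}}.$$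 Moreover, if $f$ satisfies the same hypotheses with "positive" in (F1) weakened to "nonnegative", and (1) holds with $r=0$ (so that $m=-1$ and $f^r=1$), then for all $x_1,x_2\in\Omega$ and $0<t_1<t_2<T$ $$[f(x_2,t_2)]^{|m|}\le\Big(\frac{e^{A(t_1)}}{e^{A(t_2)}}\Big)^{|m|}\Big([f(x_1,t_1)]^{|m|}+\frac{|m|\,\xi\,|x_2-x_1|^qI^{1-q}}{e^{|m|A(t_1)}}\Big).$$ -/

import Mathlib

open MeasureTheory Set
open scoped ContDiff

noncomputable section

namespace Harnack

/-- The space `ℝ^d` with its Euclidean norm. -/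
abbrev Space (d : ℕ) := EuclideanSpace ℝ (Fin d)

/-- The space-time cylinder `Ω_T = Ω × (0, T)`. -/
def cylinder {d : ℕ} (Ω : Set (Space d)) (T : ℝ) : Set (Space d × ℝ) :=
  Ω ×ˢ Ioo 0 T

/-- `g ∈ L¹_loc(U)` is the weak derivative of `f` in the direction `v` on the open set `U`:
`∫_U f ∂_v φ = - ∫_U g φ` for all `φ ∈ C_c^∞(U)`. -/
def IsWeakDeriv {d : ℕ} (U : Set (Space d × ℝ)) (v : Space d × ℝ)
    (f g : Space d × ℝ → ℝ) : Prop :=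
  LocallyIntegrableOn g U ∧
    ∀ φ : Space d × ℝ → ℝ, ContDiff ℝ ∞ φ → HasCompactSupport φ → tsupport φ ⊆ U →
      ∫ z in U, f z * fderiv ℝ φ z v = - ∫ z in U, g z * φ z

/-- `g` is the weak time derivative `∂f/∂t` of `f` on `U`. -/
def IsWeakTimeDeriv {d : ℕ} (U : Set (Space d × ℝ)) (f g : Space d × ℝ → ℝ) : Prop :=
  IsWeakDeriv U (0, 1) f g

/-- `G = (G₁, …, G_d)` is the weak spatial gradient `∇f` of `f` on `U`. -/
def IsWeakGradient {d : ℕ} (U : Set (Space d × ℝ)) (f : Space d × ℝ → ℝ)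
    (G : Space d × ℝ → Space d) : Prop :=
  ∀ i : Fin d, IsWeakDeriv U (EuclideanSpace.single i 1, 0) f (fun z => G z i)

/-- `f ∈ W^{1,1}_loc(U)`. -/
def MemW11loc {d : ℕ} (U : Set (Space d × ℝ)) (f : Space d × ℝ → ℝ) : Prop :=
  LocallyIntegrableOn f U ∧
    (∃ g, IsWeakTimeDeriv U f g) ∧ (∃ G, IsWeakGradient U f G)

/-- `t ↦ f(x(t), t)` is absolutely continuous on `[t₁, t₂]` for every continuously differentiable
curve `x : [t₁, t₂] → Ω`, `0 < t₁ < t₂ < T`. -/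
def ACOnC1Curves {d : ℕ} (Ω : Set (Space d)) (T : ℝ) (f : Space d × ℝ → ℝ) : Prop :=
  ∀ (t₁ t₂ : ℝ) (x : ℝ → Space d), 0 < t₁ → t₁ < t₂ → t₂ < T →
    ContDiffOn ℝ 1 x (Icc t₁ t₂) → MapsTo x (Icc t₁ t₂) Ω →
      AbsolutelyContinuousOnInterval (fun t => f (x t, t)) t₁ t₂

/-- For every absolutely continuous curve `x : [t₁, t₂] → Ω`, `0 < t₁ < t₂ < T`, the points
`(x(t), t)` at which `f` has no total derivative form a set of one-dimensional Hausdorff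
measure zero (with respect to the Euclidean distance of `ℝ^d × ℝ`). -/
def DiffOffNullOnACCurves {d : ℕ} (Ω : Set (Space d)) (T : ℝ) (f : Space d × ℝ → ℝ) : Prop :=
  ∀ (t₁ t₂ : ℝ) (x : ℝ → Space d), 0 < t₁ → t₁ < t₂ → t₂ < T →
    AbsolutelyContinuousOnInterval x t₁ t₂ → MapsTo x (Icc t₁ t₂) Ω →
      Measure.hausdorffMeasure 1 (WithLp.toLp 2 ''
        ({z ∈ cylinder Ω T | ¬ DifferentiableAt ℝ f z} ∩
          (fun t => (x t, t)) '' Icc t₁ t₂)) = 0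

/-- `A` is an antiderivative on `(0, T)` of the locally integrable function `a`. -/
def IsAntiderivative (T : ℝ) (a A : ℝ → ℝ) : Prop :=
  ∀ s ∈ Ioo 0 T, ∀ t ∈ Ioo 0 T, A t - A s = ∫ τ in s..t, a τ

/-- The inequality `∂f/∂t + a f ≤ - C |∇f|^p / f^r` a.e. in `Ω_T`, where `ft` and `Df` are the
weak time derivative and the weak gradient of `f`. -/
def ReversedGradientEstimate {d : ℕ} (Ω : Set (Space d)) (T : ℝ) (a : ℝ → ℝ) (C p r : ℝ)
    (f ft : Space d × ℝ → ℝ) (Df : Space d × ℝ → Space d) : Prop :=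
  ∀ᵐ z ∂(volume.restrict (cylinder Ω T)),
    ft z + a z.2 * f z ≤ - (C * ‖Df z‖ ^ p / f z ^ r)

end Harnack

end

namespace Harnack

open Topology

/-! Along a curve `x` from `x₁` to `x₂`, formally `d/dt f(x(t),t) = ∂ₜf + ∇f·x'`. Young's
inequality, with weights that absorb exactly `C|∇f|^p/f^r`, bounds this by `-a f + ξ|x'|^q f^(m+1)`
(`ae_directional_le`). The function `v = e^A f` then satisfies `v' ≤ ξ|x'|^q e^(-mA) v^(m+1)`, and a
primitive `G` of `y^(-(m+1))` separates variables. It remains to minimise `∫ |x'|^q e^(-mA)` over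
curves with given endpoints: by Hölder, the minimiser runs along the segment, which convexity keeps
inside `Ω`, at speed proportional to `e^(m(p-1)A)`, and the minimum is `|x₂-x₁|^q I^(1-q)`
(`primitive_sub_le`). The choices `G = log`, `G = -y^(-m)/m` and `G = y` give the different cases.

The difficulty is that the differential inequality holds only almost everywhere in space-time, while
a curve is a null set. The remedy is to average over small translates of the curve: the average of
`f` against a bump is differentiable along the curve, and its derivative is a weak derivative tested
against a reflected bump. Integrating in time and using continuity in the translation parameter
yields the integrated inequality on the curve itself (`sub_le_integral_of_distributional`,
`sub_le_integral_along_curve`). Absolute continuity along `C¹` curves turns this back into an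
inequality for the a.e. derivative, to which the chain rule for `G(e^A f)` applies
(`sub_le_integral_of_linear_differential_ineq`). -/

instance isAddHaarMeasure_volume_spaceTime (d : ℕ) :
    (volume : Measure (Space d × ℝ)).IsAddHaarMeasure :=
  inferInstanceAs ((volume : Measure (Space d)).prod (volume : Measure ℝ)).IsAddHaarMeasure

/-! ### Averaging over translates of a curve -/

/-- Continuity in the translation parameter of an integral along a moving curve. -/
theorem continuous_integral_translate {d : ℕ} {f : Space d × ℝ → ℝ} (hf : Continuous f) {M : ℝ}
    (hM : ∀ z, ‖f z‖ ≤ M) {a : ℝ → ℝ} (ha : Integrable a) {z : ℝ → Space d × ℝ}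
    (hz : Continuous z) (t₁ t₂ : ℝ) :
    Continuous fun w : Space d × ℝ => ∫ t in Ioc t₁ t₂, a (t - w.2) * f (z t - w) := by
  -- Substituting `τ = t - w.2` removes the translation from `a`, which is merely integrable, and
  -- puts it on the indicator and the continuous factor, so that dominated convergence applies.
  have key : ∀ w : Space d × ℝ, ∫ t in Ioc t₁ t₂, a (t - w.2) * f (z t - w) =
      ∫ τ, (Ioc t₁ t₂).indicator (fun _ => (1 : ℝ)) (τ + w.2) * (a τ * f (z (τ + w.2) - w)) := by
    intro w
    rw [← integral_indicator measurableSet_Ioc, ← integral_add_right_eq_self _ w.2]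
    congr 1 with τ
    by_cases h : τ + w.2 ∈ Ioc t₁ t₂ <;> simp [h]
  simp_rw [key]
  rw [continuous_iff_continuousAt]
  intro w
  refine continuousAt_of_dominated (bound := fun τ => ‖a τ‖ * M) ?_ ?_ (ha.norm.mul_const M) ?_
  · refine Filter.Eventually.of_forall fun v => ?_
    refine AEStronglyMeasurable.mul ?_ (ha.aestronglyMeasurable.mul ?_)
    · exact (((measurable_const.indicator measurableSet_Ioc).comp
        (measurable_id.add_const v.2))).aestronglyMeasurable
    · exact (hf.comp ((hz.comp (continuous_id.add continuous_const)).sub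
        continuous_const)).aestronglyMeasurable
  · refine Filter.Eventually.of_forall fun v => Filter.Eventually.of_forall fun τ => ?_
    have h1 : ‖(Ioc t₁ t₂).indicator (fun _ => (1 : ℝ)) (τ + v.2)‖ ≤ 1 := by
      by_cases h : τ + v.2 ∈ Ioc t₁ t₂ <;> simp [h]
    rw [norm_mul, norm_mul]
    calc _ ≤ 1 * (‖a τ‖ * M) := by
          gcongr
          exact hM _
      _ = _ := one_mul _
  -- The translated indicator is discontinuous in the parameter for only two values of `τ`.
  · have hne : ∀ c : ℝ, ∀ᵐ τ : ℝ, τ ≠ c := fun c => by simp [ae_iff, measure_singleton]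
    filter_upwards [hne (t₁ - w.2), hne (t₂ - w.2)] with τ h1 h2
    refine ContinuousAt.mul ?_ ?_
    · have : ContinuousAt ((Ioc t₁ t₂).indicator (fun _ => (1 : ℝ))) (τ + w.2) := by
        refine ContinuousOn.continuousAt_indicator ?_ ?_
        · exact continuousOn_const
        · rcases lt_or_ge t₁ t₂ with h | h
          · rw [frontier_Ioc h]
            rintro (h' | h')
            · exact h1 (by linarith)
            · exact h2 (by rw [mem_singleton_iff] at h'; linarith)
          · simp [Ioc_eq_empty (not_lt.2 h)]
      exact ContinuousAt.comp' (f := fun v : Space d × ℝ => τ + v.2) this (by fun_prop)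
    · refine Continuous.continuousAt ?_
      fun_prop

/-- The derivative along a curve of a mollification, in terms of a test function. -/
theorem hasDerivAt_mollification {d : ℕ} {f ρ : Space d × ℝ → ℝ} (hf : Continuous f)
    (hρ : ContDiff ℝ ∞ ρ) (hρc : HasCompactSupport ρ) {z : ℝ → Space d × ℝ} {v : Space d × ℝ}
    {t : ℝ} (hz : HasDerivAt z v t) :
    HasDerivAt (fun s => ∫ w, f (z s - w) * ρ w)
      (- ∫ w, f w * fderiv ℝ (fun w' => ρ (z t - w')) w v) t := by
  have h1 := (hρc.hasFDerivAt_convolution_right (ContinuousLinearMap.mul ℝ ℝ)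
    (hf.locallyIntegrable (μ := volume)) (hρ.of_le (by simp)) (z t)).comp_hasDerivAt t hz
  rw [convolution_precompR_apply _ hf.locallyIntegrable (hρc.fderiv ℝ)
    (hρ.continuous_fderiv (by simp))] at h1
  have e1 : (convolution f ρ (ContinuousLinearMap.mul ℝ ℝ) volume ∘ z) =
      fun s => ∫ w, f (z s - w) * ρ w := by
    ext s
    rw [Function.comp_apply, convolution_def]
    rw [← integral_sub_left_eq_self _ volume (z s)]
    simp
  rw [e1] at h1
  have e2 : convolution f (fun a => fderiv ℝ ρ a v) (ContinuousLinearMap.mul ℝ ℝ) volume (z t) =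
      - ∫ w, f w * fderiv ℝ (fun w' => ρ (z t - w')) w v := by
    rw [convolution_def, ← integral_neg]
    congr 1 with w
    have : HasFDerivAt (fun w' => ρ (z t - w')) ((fderiv ℝ ρ (z t - w)).comp
        (-ContinuousLinearMap.id ℝ (Space d × ℝ))) w := by
      refine HasFDerivAt.comp w (hρ.differentiable (by simp) _).hasFDerivAt ?_
      exact (hasFDerivAt_id w).const_sub (z t)
    rw [this.fderiv]
    simp
  rw [e2] at h1
  exact h1

/-- Joint integrability of the mollified right-hand side along a curve. -/
theorem integrable_mollification_prod {d : ℕ} {f ρ : Space d × ℝ → ℝ} (hf : Continuous f) {M : ℝ}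
    (hM : ∀ z, ‖f z‖ ≤ M) {a : ℝ → ℝ} (ha : Integrable a) (has : StronglyMeasurable a)
    (hρ : Continuous ρ) (hρc : HasCompactSupport ρ) {z : ℝ → Space d × ℝ}
    (hz : Continuous z) (t₁ t₂ : ℝ) :
    Integrable (fun y : ℝ × (Space d × ℝ) => a (y.1 - y.2.2) * f (z y.1 - y.2) * ρ y.2)
      ((volume.restrict (Ioc t₁ t₂)).prod volume) := by
  have hm : AEStronglyMeasurable
      (fun y : ℝ × (Space d × ℝ) => a (y.1 - y.2.2) * f (z y.1 - y.2) * ρ y.2)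
      ((volume.restrict (Ioc t₁ t₂)).prod volume) := by
    refine StronglyMeasurable.aestronglyMeasurable ?_
    refine ((has.comp_measurable (by fun_prop)).mul ?_).mul ?_
    · exact Continuous.stronglyMeasurable (by fun_prop)
    · exact Continuous.stronglyMeasurable (by fun_prop)
  have hM0 : 0 ≤ M := (norm_nonneg _).trans (hM 0)
  have hint : ∀ w : Space d × ℝ, Integrable (fun t => a (t - w.2) * f (z t - w)) := by
    intro w
    refine (ha.comp_sub_right w.2).mul_bdd (c := M) ?_ (Filter.Eventually.of_forall fun t => hM _)
    exact Continuous.aestronglyMeasurable (by fun_prop)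
  -- The time integral is taken first: for fixed `w`, translation invariance bounds it by `M ‖a‖₁ |ρ
  -- w|`.
  rw [integrable_prod_iff' hm]
  refine ⟨Filter.Eventually.of_forall fun w => ((hint w).mul_const (ρ w)).restrict, ?_⟩
  refine Integrable.mono' (g := fun w => (M * ∫ t, ‖a t‖) * ‖ρ w‖)
    (((hρ.integrable_of_hasCompactSupport hρc).norm).const_mul _)
    hm.norm.prod_swap.integral_prod_right' (Filter.Eventually.of_forall fun w => ?_)
  rw [Real.norm_of_nonneg (integral_nonneg fun _ => norm_nonneg _)]
  calc ∫ t in Ioc t₁ t₂, ‖a (t - w.2) * f (z t - w) * ρ w‖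
      ≤ ∫ t, ‖a (t - w.2) * f (z t - w) * ρ w‖ :=
        setIntegral_le_integral ((hint w).mul_const _).norm
          (Filter.Eventually.of_forall fun _ => norm_nonneg _)
    _ ≤ ∫ t, ‖a (t - w.2)‖ * (M * ‖ρ w‖) := by
        refine integral_mono ((hint w).mul_const _).norm
          ((ha.comp_sub_right w.2).norm.mul_const _) fun t => ?_
        simp only [norm_mul, mul_assoc]
        gcongr
        exact hM _
    _ = _ := by
        rw [integral_mul_const, integral_sub_right_eq_self (fun t => ‖a t‖) w.2]
        ring

/-- A function satisfying a differential inequality along a curve in the sense of distributions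
satisfies the integrated inequality on that curve. -/
theorem sub_le_integral_of_distributional {d : ℕ} {f B : Space d × ℝ → ℝ} (hf : Continuous f)
    (hB : Continuous B) {M : ℝ} (hM : ∀ z, ‖f z‖ ≤ M) (hBM : ∀ z, ‖B z‖ ≤ M)
    {a : ℝ → ℝ} (ha : Integrable a) (has : StronglyMeasurable a) {k : ℝ → ℝ} (hk : Continuous k)
    {x x' : ℝ → Space d} (hx : ∀ t, HasDerivAt x (x' t) t) {t₁ t₂ : ℝ} (h12 : t₁ ≤ t₂)
    {δ : ℝ} (hδ : 0 < δ)
    (H : ∀ t ∈ Icc t₁ t₂, ∀ φ : Space d × ℝ → ℝ, ContDiff ℝ ∞ φ → HasCompactSupport φ →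
      tsupport φ ⊆ Metric.closedBall (x t, t) δ → (∀ z, 0 ≤ φ z) →
      - ∫ z, f z * fderiv ℝ φ z (x' t, 1) ≤ ∫ z, (a z.2 * f z + k t * B z) * φ z) :
    f (x t₂, t₂) - f (x t₁, t₁) ≤
      ∫ t in t₁..t₂, (a t * f (x t, t) + k t * B (x t, t)) := by
  have hxc : Continuous x := continuous_iff_continuousAt.2 fun t => (hx t).continuousAt
  set z : ℝ → Space d × ℝ := fun t => (x t, t) with hzdef
  have hzc : Continuous z := hxc.prodMk continuous_id
  have hzd : ∀ t, HasDerivAt z (x' t, 1) t := fun t => (hx t).prodMk (hasDerivAt_id t)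
  set J : Space d × ℝ → ℝ := fun w =>
    (∫ t in Ioc t₁ t₂, a (t - w.2) * f (z t - w)) + ∫ t in Ioc t₁ t₂, k t * B (z t - w) with hJ
  have hkI : IntegrableOn k (Ioc t₁ t₂) := (hk.integrableOn_Icc).mono_set Ioc_subset_Icc_self
  have hJ2 : Continuous fun w => ∫ t in Ioc t₁ t₂, k t * B (z t - w) := by
    have := intervalIntegral.continuous_parametric_intervalIntegral_of_continuous' (μ := volume)
      (f := fun (w : Space d × ℝ) t => k t * B (z t - w)) (by fun_prop) t₁ t₂
    simpa only [intervalIntegral.integral_of_le h12] using this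
  have hJc : Continuous J := (continuous_integral_translate hf hM ha hzc t₁ t₂).add hJ2
  -- `Q w` is the defect of the integrated inequality on the curve translated by `-w`. It is
  -- continuous, so if `Q 0 > 0` its average against a concentrated bump would be positive; the
  -- distributional inequality makes that average nonpositive.
  set Q : Space d × ℝ → ℝ := fun w => f (z t₂ - w) - f (z t₁ - w) - J w with hQ
  have hQc : Continuous Q := by fun_prop
  have hgoal : Q 0 ≤ 0 → f (x t₂, t₂) - f (x t₁, t₁) ≤
      ∫ t in t₁..t₂, (a t * f (x t, t) + k t * B (x t, t)) := by
    intro h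
    rw [intervalIntegral.integral_of_le h12, integral_add]
    · simpa [hQ, hJ, hzdef] using h
    · refine (ha.mul_bdd (c := M) ?_ (Filter.Eventually.of_forall fun t => hM _)).restrict
      exact Continuous.aestronglyMeasurable (by fun_prop)
    · exact hkI.mul_bdd (c := M) (Continuous.aestronglyMeasurable (by fun_prop))
        (Filter.Eventually.of_forall fun t => hBM _)
  apply hgoal
  by_contra! hpos
  obtain ⟨ε, hε, hball⟩ := Metric.eventually_nhds_iff_ball.1
    ((hQc.tendsto 0).eventually (lt_mem_nhds hpos))
  -- `ε` keeps `Q` positive on the support of the bump; `δ` keeps the reflected bumps among the test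
  -- functions allowed in `H`.
  set η := min ε δ with hη
  have hη0 : 0 < η := lt_min hε hδ
  let ρ : ContDiffBump (0 : Space d × ℝ) := ⟨η / 2, η, by positivity, by linarith⟩
  have hρ : ContDiff ℝ ∞ ρ := ρ.contDiff
  have hρc : HasCompactSupport ρ := ρ.hasCompactSupport
  have hρcont : Continuous ρ := hρ.continuous
  have hQint : Integrable fun w => Q w * ρ w :=
    (hQc.mul hρcont).integrable_of_hasCompactSupport hρc.mul_left
  have hQpos : 0 < ∫ w, Q w * ρ w := by
    rw [integral_pos_iff_support_of_nonneg_ae _ hQint]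
    · refine lt_of_lt_of_le (Metric.measure_ball_pos volume (0 : Space d × ℝ) hη0)
        (measure_mono fun w hw => ?_)
      have h1 : 0 < Q w := hball w (Metric.ball_subset_ball (min_le_left _ _) hw)
      have h2 : 0 < ρ w := ρ.pos_of_mem_ball hw
      exact (mul_pos h1 h2).ne'
    · refine Filter.Eventually.of_forall fun w => ?_
      by_cases hw : w ∈ Metric.ball (0 : Space d × ℝ) η
      · have h1 : 0 < Q w := hball w (Metric.ball_subset_ball (min_le_left _ _) hw)
        exact mul_nonneg h1.le ρ.nonneg
      · have : ρ w = 0 := ρ.zero_of_le_dist (by simpa using hw)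
        simp [this]
  have hfub1 := integrable_mollification_prod hf hM ha has hρcont hρc hzc t₁ t₂
  have hfub2 : Integrable (fun y : ℝ × (Space d × ℝ) => k y.1 * B (z y.1 - y.2) * ρ y.2)
      ((volume.restrict (Ioc t₁ t₂)).prod volume) := by
    have h0 := hkI.mul_prod (hρcont.integrable_of_hasCompactSupport hρc (μ := volume))
    have h1 := h0.mul_bdd (c := M) (g := fun y : ℝ × (Space d × ℝ) => B (z y.1 - y.2))
      (Continuous.aestronglyMeasurable (by fun_prop)) (Filter.Eventually.of_forall fun t => hBM _)
    refine h1.congr (Filter.Eventually.of_forall fun y => ?_)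
    ring
  have hfub := hfub1.add hfub2
  set h : ℝ → ℝ := fun t => ∫ w, (a (t - w.2) * f (z t - w) * ρ w + k t * B (z t - w) * ρ w)
  set F : ℝ → ℝ := fun t => ∫ w, f (z t - w) * ρ w with hF
  have hFd := fun t => hasDerivAt_mollification hf hρ hρc (hzd t)
  have hFle : F t₂ - F t₁ ≤ ∫ t in t₁..t₂, h t := by
    refine intervalIntegral.sub_le_integral_of_hasDeriv_right_of_le h12
      (fun t _ => (hFd t).continuousAt.continuousWithinAt)
      (fun t _ => (hFd t).hasDerivWithinAt) ?_ ?_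
    · rw [integrableOn_Icc_iff_integrableOn_Ioc]
      exact hfub.integral_prod_left
    · intro t ht
      have hsupp : tsupport (fun w' => ρ (z t - w')) ⊆ Metric.closedBall (x t, t) δ := by
        refine closure_minimal ?_ Metric.isClosed_closedBall
        intro w hw
        by_contra hcon
        refine hw (ρ.zero_of_le_dist ?_)
        rw [Metric.mem_closedBall, not_le, dist_comm, dist_eq_norm] at hcon
        rw [dist_zero_right]
        exact (min_le_right _ _).trans hcon.le
      refine (H t (Ioo_subset_Icc_self ht) (fun w' => ρ (z t - w'))
        (hρ.comp (contDiff_const.sub contDiff_id)) ?_ hsupp fun w => ρ.nonneg).trans_eq ?_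
      · exact (isCompact_closedBall (x t, t) δ).of_isClosed_subset (isClosed_tsupport _) hsupp
      · rw [← integral_sub_left_eq_self _ volume (z t)]
        refine integral_congr_ae (Filter.Eventually.of_forall fun w => ?_)
        simp [hzdef]
        ring
  have hswap : ∫ t in t₁..t₂, h t = ∫ w, J w * ρ w := by
    rw [intervalIntegral.integral_of_le h12, integral_integral_swap hfub]
    refine integral_congr_ae ?_
    filter_upwards [hfub1.prod_left_ae, hfub2.prod_left_ae] with w h1 h2
    rw [integral_add h1 h2, integral_mul_const, integral_mul_const, hJ]
    ring
  have hfi : ∀ t, Integrable fun w => f (z t - w) * ρ w := fun t =>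
    Continuous.integrable_of_hasCompactSupport (by fun_prop) hρc.mul_left
  have hQeq : ∫ w, Q w * ρ w = F t₂ - F t₁ - ∫ w, J w * ρ w := by
    have hfd : Integrable fun w => f (z t₂ - w) * ρ w - f (z t₁ - w) * ρ w :=
      (hfi _).sub (hfi _)
    rw [hF, ← integral_sub (hfi _) (hfi _), ← integral_sub hfd]
    · congr 1 with w
      simp only [hQ]
      ring
    · exact (hJc.mul hρcont).integrable_of_hasCompactSupport hρc.mul_left
  linarith

/-! ### Weak derivatives tested in space-time directions -/

theorem integrable_mul_of_tsupport_subset {d : ℕ} {U : Set (Space d × ℝ)}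
    {h ψ : Space d × ℝ → ℝ} (hh : LocallyIntegrableOn h U) (hψ : Continuous ψ)
    (hψc : HasCompactSupport ψ) (hψU : tsupport ψ ⊆ U) : Integrable fun z => h z * ψ z := by
  have h1 : IntegrableOn h (tsupport ψ) := hh.integrableOn_compact_subset hψU hψc
  have h2 : IntegrableOn (fun z => h z * ψ z) (tsupport ψ) :=
    h1.mul_continuousOn hψ.continuousOn hψc
  refine (integrableOn_iff_integrable_of_support_subset ?_).1 h2
  intro z hz
  exact subset_tsupport _ (right_ne_zero_of_mul hz)

theorem setIntegral_mul_eq_integral {d : ℕ} {U : Set (Space d × ℝ)}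
    {h ψ : Space d × ℝ → ℝ} (hψU : tsupport ψ ⊆ U) :
    ∫ z in U, h z * ψ z = ∫ z, h z * ψ z := by
  refine setIntegral_eq_integral_of_forall_compl_eq_zero fun z hz => ?_
  rw [image_eq_zero_of_notMem_tsupport fun h => hz (hψU h), mul_zero]

theorem tsupport_fderiv_apply_subset {d : ℕ} (φ : Space d × ℝ → ℝ) (v : Space d × ℝ) :
    tsupport (fun z => fderiv ℝ φ z v) ⊆ tsupport φ := by
  refine closure_minimal (fun z hz => ?_) (isClosed_tsupport _)
  refine support_fderiv_subset ℝ (f := φ) fun h0 => hz ?_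
  simp [h0]

/-- The weak derivative in the space-time direction `(e, 1)`. -/
theorem integral_mul_fderiv_eq {d : ℕ} {U : Set (Space d × ℝ)} (hU : IsOpen U)
    {f ft : Space d × ℝ → ℝ} {Df : Space d × ℝ → Space d} (hf : ContinuousOn f U)
    (hft : IsWeakTimeDeriv U f ft) (hDf : IsWeakGradient U f Df) (e : Space d)
    {φ : Space d × ℝ → ℝ} (hφ : ContDiff ℝ ∞ φ) (hφc : HasCompactSupport φ)
    (hφU : tsupport φ ⊆ U) :
    Integrable (fun z => (ft z + inner ℝ (Df z) e) * φ z) ∧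
    ∫ z, f z * fderiv ℝ φ z (e, 1) = - ∫ z, (ft z + inner ℝ (Df z) e) * φ z := by
  have hfl : LocallyIntegrableOn f U := hf.locallyIntegrableOn hU.measurableSet
  have hd : ∀ v, Continuous fun z => fderiv ℝ φ z v := fun v =>
    (hφ.continuous_fderiv (by simp)).clm_apply continuous_const
  have hdU : ∀ v, tsupport (fun z => fderiv ℝ φ z v) ⊆ U := fun v =>
    (tsupport_fderiv_apply_subset φ v).trans hφU
  have hdc : ∀ v, HasCompactSupport fun z => fderiv ℝ φ z v := fun v =>
    hφc.of_isClosed_subset (isClosed_tsupport _) (tsupport_fderiv_apply_subset φ v)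
  have hfi : ∀ v, Integrable fun z => f z * fderiv ℝ φ z v := fun v =>
    integrable_mul_of_tsupport_subset hfl (hd v) (hdc v) (hdU v)
  have hti : Integrable fun z => ft z * φ z :=
    integrable_mul_of_tsupport_subset hft.1 hφ.continuous hφc hφU
  have hxi : ∀ i, Integrable fun z => Df z i * φ z := fun i =>
    integrable_mul_of_tsupport_subset (hDf i).1 hφ.continuous hφc hφU
  have ht : ∫ z, f z * fderiv ℝ φ z (0, 1) = - ∫ z, ft z * φ z := by
    rw [← setIntegral_mul_eq_integral (hdU _), ← setIntegral_mul_eq_integral hφU]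
    exact hft.2 φ hφ hφc hφU
  have hx : ∀ i, ∫ z, f z * fderiv ℝ φ z (EuclideanSpace.single i 1, 0) =
      - ∫ z, Df z i * φ z := fun i => by
    rw [← setIntegral_mul_eq_integral (hdU _),
      ← setIntegral_mul_eq_integral (h := fun z => Df z i) hφU]
    exact (hDf i).2 φ hφ hφc hφU
  have hv : ((e, 1) : Space d × ℝ) = (0, 1) + ∑ i, e i • (EuclideanSpace.single i (1 : ℝ), (0 : ℝ)) := by
    ext j
    · simp [Prod.fst_sum, Pi.single_apply]
    · simp [Prod.snd_sum]
  have hexp : ∀ z, f z * fderiv ℝ φ z (e, 1) = f z * fderiv ℝ φ z (0, 1) +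
      ∑ i, e i * (f z * fderiv ℝ φ z (EuclideanSpace.single i 1, 0)) := by
    intro z
    rw [hv, map_add, map_sum, mul_add, Finset.mul_sum]
    congr 1
    refine Finset.sum_congr rfl fun i _ => ?_
    rw [map_smul, smul_eq_mul]
    ring
  have hexp' : ∀ z, (ft z + inner ℝ (Df z) e) * φ z = ft z * φ z +
      ∑ i, e i * (Df z i * φ z) := by
    intro z
    rw [PiLp.inner_apply, add_mul, Finset.sum_mul]
    congr 1
    refine Finset.sum_congr rfl fun i _ => ?_
    simp
    ring
  simp_rw [hexp, hexp']
  refine ⟨hti.add (integrable_finsetSum _ fun i _ => (hxi i).const_mul _), ?_⟩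
  rw [integral_add (hfi _) (integrable_finsetSum _ fun i _ => (hfi _).const_mul _),
    integral_add hti (integrable_finsetSum _ fun i _ => (hxi i).const_mul _),
    integral_finsetSum _ fun i _ => (hfi _).const_mul _,
    integral_finsetSum _ fun i _ => (hxi i).const_mul _, ht, neg_add, ← Finset.sum_neg_distrib]
  congr 1
  refine Finset.sum_congr rfl fun i _ => ?_
  rw [integral_const_mul, integral_const_mul, hx i]
  ring

/-! ### From the a.e. inequality on the cylinder to a curve -/

/-- Tietze's theorem. The averaging argument wants globally bounded continuous functions, while `f`
is controlled only on compact subsets of the cylinder. -/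
theorem exists_bounded_extension {d : ℕ} {K : Set (Space d × ℝ)} (hK : IsCompact K)
    {f : Space d × ℝ → ℝ} (hf : ContinuousOn f K) :
    ∃ (g : Space d × ℝ → ℝ) (M : ℝ), Continuous g ∧ (∀ z, ‖g z‖ ≤ M) ∧ EqOn g f K := by
  obtain ⟨M, hM⟩ := hK.exists_bound_of_continuousOn hf
  obtain ⟨g, hg, hgf⟩ := ContinuousMap.exists_restrict_eq_forall_mem_of_closed
    (⟨K.domRestrict f, hf.domRestrict⟩ : C(K, ℝ)) (t := Icc (-|M|) |M|)
    (fun y => by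
      have := (hM y y.2).trans (le_abs_self M)
      exact abs_le.1 this) ⟨0, by simp⟩ hK.isClosed
  refine ⟨g, |M|, g.continuous, fun z => ?_, fun z hz => ?_⟩
  · rw [Real.norm_eq_abs, abs_le]
    exact hg z
  · exact congrArg (fun h : C(K, ℝ) => h ⟨z, hz⟩) hgf

/-- The integrated differential inequality along a `C¹` curve in the cylinder. -/
theorem sub_le_integral_along_curve {d : ℕ} {Ω : Set (Space d)} (hΩ : IsOpen Ω) {T : ℝ}
    {f ft B : Space d × ℝ → ℝ} {Df : Space d × ℝ → Space d} {a k : ℝ → ℝ}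
    (hf : ContinuousOn f (cylinder Ω T)) (hB : ContinuousOn B (cylinder Ω T))
    (hft : IsWeakTimeDeriv (cylinder Ω T) f ft) (hDf : IsWeakGradient (cylinder Ω T) f Df)
    (ha : LocallyIntegrableOn a (Ioo 0 T)) (hk : Continuous k)
    {x x' : ℝ → Space d} (hx : ∀ t, HasDerivAt x (x' t) t)
    {t₁ t₂ : ℝ} (h1 : 0 < t₁) (h12 : t₁ ≤ t₂) (h2 : t₂ < T) (hxΩ : MapsTo x (Icc t₁ t₂) Ω)
    (H : ∀ᵐ z ∂(volume.restrict (cylinder Ω T)), ∀ t,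
      ft z + inner ℝ (Df z) (x' t) ≤ - a z.2 * f z + k t * B z) :
    f (x t₂, t₂) - f (x t₁, t₁) ≤
      ∫ t in t₁..t₂, (- a t * f (x t, t) + k t * B (x t, t)) := by
  have hU : IsOpen (cylinder Ω T) := hΩ.prod isOpen_Ioo
  have hxc : Continuous x := continuous_iff_continuousAt.2 fun t => (hx t).continuousAt
  have hzc : Continuous fun t => (x t, t) := hxc.prodMk continuous_id
  have hΓ : IsCompact ((fun t => (x t, t)) '' Icc t₁ t₂) := isCompact_Icc.image hzc
  have hΓU : (fun t => (x t, t)) '' Icc t₁ t₂ ⊆ cylinder Ω T := by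
    rintro _ ⟨t, ht, rfl⟩
    exact ⟨hxΩ ht, h1.trans_le ht.1, ht.2.trans_lt h2⟩
  obtain ⟨δ, hδ, hδU⟩ := hΓ.exists_cthickening_subset_open hU hΓU
  set K := Metric.cthickening δ ((fun t => (x t, t)) '' Icc t₁ t₂) with hKdef
  have hK : IsCompact K := hΓ.cthickening
  have hballK : ∀ t ∈ Icc t₁ t₂, Metric.closedBall (x t, t) δ ⊆ K := by
    intro t ht
    have hm : (x t, t) ∈ (fun t => (x t, t)) '' Icc t₁ t₂ := ⟨t, ht, rfl⟩
    exact Metric.closedBall_subset_cthickening hm δ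
  obtain ⟨g, M, hg, hgM, hgf⟩ := exists_bounded_extension hK (hf.mono hδU)
  obtain ⟨b, N, hb, hbN, hbB⟩ := exists_bounded_extension hK (hB.mono hδU)
  -- The extreme times are read off from two points of `K` above and below the ends of the curve.
  have hsub : Icc (t₁ - δ) (t₂ + δ) ⊆ Ioo 0 T := by
    have m1 : (x t₁, t₁ - δ) ∈ cylinder Ω T := by
      refine hδU (hballK t₁ ⟨le_rfl, h12⟩ ?_)
      simp [hδ.le, abs_of_pos hδ, dist_eq_norm]
    have m2 : (x t₂, t₂ + δ) ∈ cylinder Ω T := by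
      refine hδU (hballK t₂ ⟨h12, le_rfl⟩ ?_)
      simp [hδ.le, abs_of_pos hδ, dist_eq_norm]
    exact fun t ht => ⟨m1.2.1.trans_le ht.1, ht.2.trans_lt m2.2.2⟩
  have haI : Integrable ((Icc (t₁ - δ) (t₂ + δ)).indicator fun t => - a t) :=
    (integrable_indicator_iff measurableSet_Icc).2
      (ha.integrableOn_compact_subset hsub isCompact_Icc).neg
  -- `-a` is cut off to be globally integrable and replaced by a strongly measurable representative.
  -- The change on a null set of times is harmless both in space-time and along the curve.
  set α := haI.aestronglyMeasurable.mk _ with hα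
  have hαs : StronglyMeasurable α := haI.aestronglyMeasurable.stronglyMeasurable_mk
  have hαe : (Icc (t₁ - δ) (t₂ + δ)).indicator (fun t => - a t) =ᵐ[volume] α :=
    haI.aestronglyMeasurable.ae_eq_mk
  have hαI : Integrable α := haI.congr hαe
  have hαz : ∀ᵐ z : Space d × ℝ,
      (Icc (t₁ - δ) (t₂ + δ)).indicator (fun t => - a t) z.2 = α z.2 :=
    Measure.quasiMeasurePreserving_snd.ae hαe
  have main := sub_le_integral_of_distributional hg hb
    (fun z => (hgM z).trans (le_max_left M N)) (fun z => (hbN z).trans (le_max_right M N))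
    hαI hαs hk hx h12 hδ ?_
  · have hmem : ∀ t ∈ Icc t₁ t₂, (x t, t) ∈ K := fun t ht =>
      hballK t ht (Metric.mem_closedBall_self hδ.le)
    rw [hgf (hmem t₂ ⟨h12, le_rfl⟩), hgf (hmem t₁ ⟨le_rfl, h12⟩)] at main
    refine main.trans_eq ?_
    refine intervalIntegral.integral_congr_ae ?_
    filter_upwards [hαe] with t ht htI
    rw [uIoc_of_le h12] at htI
    have htI' := Ioc_subset_Icc_self htI
    rw [hgf (hmem t htI'), hbB (hmem t htI'), ← ht, indicator_of_mem]
    exact ⟨by linarith [htI'.1], by linarith [htI'.2]⟩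
  · intro t ht φ hφ hφc hφD hφ0
    have hφK : tsupport φ ⊆ K := hφD.trans (hballK t ht)
    have hφU := hφK.trans hδU
    obtain ⟨hGi, hGe⟩ := integral_mul_fderiv_eq hU hf hft hDf (x' t) hφ hφc hφU
    have e1 : ∫ z, g z * fderiv ℝ φ z (x' t, 1) = ∫ z, f z * fderiv ℝ φ z (x' t, 1) := by
      congr 1 with z
      by_cases hz : z ∈ tsupport (fun z => fderiv ℝ φ z (x' t, 1))
      · rw [hgf (hφK (tsupport_fderiv_apply_subset _ _ hz))]
      · rw [image_eq_zero_of_notMem_tsupport hz, mul_zero, mul_zero]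
    rw [e1, hGe, neg_neg]
    have hα2 : IntegrableOn (fun z : Space d × ℝ => α z.2)
        (Metric.closedBall (x t) δ ×ˢ univ) := by
      have h0 : Integrable (fun _ : Space d => (1 : ℝ))
          (volume.restrict (Metric.closedBall (x t) δ)) :=
        integrableOn_const (isCompact_closedBall _ _).measure_lt_top.ne
      have := h0.mul_prod hαI
      rw [← Measure.restrict_univ (μ := (volume : Measure ℝ)), Measure.prod_restrict] at this
      simpa [IntegrableOn, Measure.volume_eq_prod] using this
    have hsuppD : tsupport φ ⊆ Metric.closedBall (x t) δ ×ˢ univ := fun z hz => by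
      have := hφD hz
      rw [← closedBall_prod_same] at this
      exact ⟨this.1, mem_univ _⟩
    have hRi : Integrable fun z => (α z.2 * g z + k t * b z) * φ z := by
      have i1 : IntegrableOn (fun z => (α z.2 * g z + k t * b z) * φ z) (tsupport φ) := by
        refine IntegrableOn.mul_continuousOn ?_ hφ.continuous.continuousOn hφc
        refine ((hα2.mono_set hsuppD).mul_continuousOn hg.continuousOn hφc).add ?_
        exact ContinuousOn.integrableOn_compact hφc (by fun_prop)
      refine (integrableOn_iff_integrable_of_support_subset fun z hz => ?_).1 i1
      exact subset_tsupport _ (right_ne_zero_of_mul hz)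
    refine integral_mono_ae hGi hRi ?_
    filter_upwards [hαz, (ae_restrict_iff' hU.measurableSet).1 H] with z hz1 hz2
    by_cases hz : z ∈ tsupport φ
    · have hzD := hφD hz
      rw [← closedBall_prod_same] at hzD
      have hzt : z.2 ∈ Icc (t₁ - δ) (t₂ + δ) := by
        have := hzD.2
        rw [Real.closedBall_eq_Icc] at this
        exact ⟨by linarith [this.1, ht.1], by linarith [this.2, ht.2]⟩
      rw [← hz1, indicator_of_mem hzt, hgf (hφK hz), hbB (hφK hz)]
      exact mul_le_mul_of_nonneg_right (hz2 (hφU hz) t) (hφ0 z)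
    · rw [image_eq_zero_of_notMem_tsupport hz, mul_zero, mul_zero]

/-! ### Differential inequalities for absolutely continuous functions -/

/-- The image of the interval under `f` is compact and convex, so the `C¹` function `φ` is Lipschitz
on it. -/
theorem absolutelyContinuousOnInterval_comp {φ f : ℝ → ℝ} {S : Set ℝ} {a b : ℝ}
    (hφ : ContDiffOn ℝ 1 φ S) (hf : AbsolutelyContinuousOnInterval f a b)
    (hfS : MapsTo f (uIcc a b) S) : AbsolutelyContinuousOnInterval (fun t => φ (f t)) a b := by
  have hc : IsCompact (f '' uIcc a b) := isCompact_uIcc.image_of_continuousOn hf.continuousOn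
  have hcv : Convex ℝ (f '' uIcc a b) :=
    (isPreconnected_uIcc.image f hf.continuousOn).ordConnected.convex
  obtain ⟨L, hL⟩ := (hφ.mono hfS.image_subset).exists_lipschitzOnWith one_ne_zero hcv hc
  have hmem : ∀ t ∈ uIcc a b, f t ∈ f '' uIcc a b := fun t ht => mem_image_of_mem f ht
  rw [absolutelyContinuousOnInterval_iff] at hf ⊢
  intro ε hε
  obtain ⟨δ, hδ, H⟩ := hf (ε / (L + 1)) (by positivity)
  refine ⟨δ, hδ, fun E hE hEδ => ?_⟩
  have h1 := H E hE hEδ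
  rw [lt_div_iff₀ (by positivity)] at h1
  refine lt_of_le_of_lt ?_ h1
  rw [Finset.sum_mul]
  refine Finset.sum_le_sum fun i hi => ?_
  have h2 := hL.dist_le_mul _ (hmem _ (hE.1 i hi).1) _ (hmem _ (hE.1 i hi).2)
  nlinarith [dist_nonneg (x := f (E.2 i).1) (y := f (E.2 i).2)]

/-- The hypothesis says that `∫ h - u` is monotone, and by Lebesgue differentiation its derivative
is `h - u'` almost everywhere. -/
theorem ae_deriv_le_of_sub_le_integral {u h : ℝ → ℝ} {t₁ t₂ : ℝ} (h12 : t₁ ≤ t₂)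
    (hu : AbsolutelyContinuousOnInterval u t₁ t₂) (hh : IntervalIntegrable h volume t₁ t₂)
    (H : ∀ s ∈ Icc t₁ t₂, ∀ t ∈ Icc t₁ t₂, s ≤ t → u t - u s ≤ ∫ τ in s..t, h τ) :
    ∀ᵐ t, t ∈ uIcc t₁ t₂ → deriv u t ≤ h t := by
  have hne : ∀ c : ℝ, ∀ᵐ τ : ℝ, τ ≠ c := fun c => by simp [ae_iff, measure_singleton]
  filter_upwards [hu.ae_differentiableAt, hh.ae_hasDerivAt_integral, hne t₁, hne t₂]
    with t hut hht ht1 ht2 ht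
  have hd := (hht ht t₁ left_mem_uIcc).sub (hut ht).hasDerivAt
  rw [uIcc_of_le h12] at ht
  have hmono : MonotoneOn ((fun x => ∫ τ in t₁..x, h τ) - u) (Icc t₁ t₂) := by
    intro s hs r hr hsr
    have hi : ∀ {c e : ℝ}, c ∈ Icc t₁ t₂ → e ∈ Icc t₁ t₂ → IntervalIntegrable h volume c e := by
      intro c e hc he
      refine hh.mono_set ?_
      rw [uIcc_of_le h12]
      exact Set.OrdConnected.uIcc_subset inferInstance hc he
    have := intervalIntegral.integral_add_adjacent_intervals
      (hi ⟨le_rfl, h12⟩ hs) (hi hs hr)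
    have h3 := H s hs r hr hsr
    simp only [Pi.sub_apply]
    linarith
  have hnh : Icc t₁ t₂ ∈ 𝓝 t :=
    Icc_mem_nhds (lt_of_le_of_ne ht.1 (Ne.symm ht1)) (lt_of_le_of_ne ht.2 ht2)
  have h4 := hmono.derivWithin_nonneg (x := t)
  rw [derivWithin_of_mem_nhds hnh, hd.deriv] at h4
  linarith

/-- Integration of `u' ≤ -a u + κ` after the change of variable `G (e^A u)`. -/
theorem sub_le_integral_of_linear_differential_ineq {u a A κ l G : ℝ → ℝ} {S : Set ℝ} {t₁ t₂ : ℝ}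
    (h12 : t₁ ≤ t₂) (hu : AbsolutelyContinuousOnInterval u t₁ t₂)
    (ha : IntervalIntegrable a volume t₁ t₂)
    (hA : ∀ t ∈ Icc t₁ t₂, A t - A t₁ = ∫ τ in t₁..t, a τ)
    (hκ : IntervalIntegrable κ volume t₁ t₂)
    (H : ∀ s ∈ Icc t₁ t₂, ∀ t ∈ Icc t₁ t₂, s ≤ t → u t - u s ≤ ∫ τ in s..t, (- a τ * u τ + κ τ))
    (hSo : IsOpen S) (hG : ContDiffOn ℝ 1 G S)
    (hv : ∀ t ∈ Icc t₁ t₂, Real.exp (A t) * u t ∈ S)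
    (hG0 : ∀ y ∈ S, 0 ≤ deriv G y) (hl : IntervalIntegrable l volume t₁ t₂)
    (hle : ∀ t ∈ Icc t₁ t₂,
      deriv G (Real.exp (A t) * u t) * (Real.exp (A t) * κ t) ≤ l t) :
    G (Real.exp (A t₂) * u t₂) - G (Real.exp (A t₁) * u t₁) ≤ ∫ t in t₁..t₂, l t := by
  have hne : ∀ c : ℝ, ∀ᵐ τ : ℝ, τ ≠ c := fun c => by simp [ae_iff, measure_singleton]
  -- `A` is controlled only on `[t₁, t₂]`; this copy is an explicit integral, hence absolutely
  -- continuous with derivative `a` almost everywhere.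
  set A' : ℝ → ℝ := fun t => A t₁ + ∫ τ in t₁..t, a τ with hA'def
  have hAA : ∀ t ∈ Icc t₁ t₂, A t = A' t := fun t ht => by
    simp only [hA'def]
    linarith [hA t ht]
  have hA'AC : AbsolutelyContinuousOnInterval A' t₁ t₂ := by
    have hc : AbsolutelyContinuousOnInterval (fun _ : ℝ => A t₁) t₁ t₂ :=
      contDiffOn_const.absolutelyContinuousOnInterval
    exact hc.fun_add (ha.absolutelyContinuousOnInterval_intervalIntegral left_mem_uIcc)
  have hE : AbsolutelyContinuousOnInterval (fun t => Real.exp (A' t)) t₁ t₂ :=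
    absolutelyContinuousOnInterval_comp (S := univ) Real.contDiff_exp.contDiffOn
      hA'AC (mapsTo_univ _ _)
  have hV : AbsolutelyContinuousOnInterval (fun t => Real.exp (A' t) * u t) t₁ t₂ := hE.fun_mul hu
  have hVS : MapsTo (fun t => Real.exp (A' t) * u t) (uIcc t₁ t₂) S := by
    intro t ht
    rw [uIcc_of_le h12] at ht
    simpa only [hAA t ht] using hv t ht
  have hW := absolutelyContinuousOnInterval_comp hG hV hVS
  rw [hAA t₂ ⟨h12, le_rfl⟩, hAA t₁ ⟨le_rfl, h12⟩, ← hW.integral_deriv_eq_sub]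
  refine intervalIntegral.integral_mono_ae_restrict h12 hW.intervalIntegrable_deriv hl ?_
  rw [Filter.EventuallyLE, ae_restrict_iff' measurableSet_Icc]
  have hh : IntervalIntegrable (fun τ => - a τ * u τ + κ τ) volume t₁ t₂ :=
    (ha.neg.mul_continuousOn hu.continuousOn).add hκ
  filter_upwards [ae_deriv_le_of_sub_le_integral h12 hu hh H, hu.ae_differentiableAt,
    ha.ae_hasDerivAt_integral] with t h1 h2 h3 ht
  have ht' : t ∈ uIcc t₁ t₂ := by rwa [uIcc_of_le h12]
  have hdA : HasDerivAt A' (a t) t := (h3 ht' t₁ left_mem_uIcc).const_add (A t₁)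
  have hdV := hdA.exp.mul (h2 ht').hasDerivAt
  have hVt : Real.exp (A' t) * u t ∈ S := hVS ht'
  have hdG : HasDerivAt G (deriv G (Real.exp (A' t) * u t)) (Real.exp (A' t) * u t) :=
    ((hG.differentiableOn one_ne_zero).differentiableAt (hSo.mem_nhds hVt)).hasDerivAt
  have hdW : HasDerivAt (fun t => G (Real.exp (A' t) * u t)) _ t := hdG.comp t hdV
  rw [hdW.deriv]
  refine le_trans ?_ (hle t ht)
  rw [hAA t ht]
  refine mul_le_mul_of_nonneg_left ?_ (hG0 _ hVt)
  have h5 := mul_le_mul_of_nonneg_left (h1 ht') (Real.exp_pos (A' t)).le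
  nlinarith

/-! ### Young's inequality and the optimal curve -/

/-- Young's inequality with the optimal constant for the integrand `C s ^ p / F`. -/
theorem mul_le_young {C p q F s b : ℝ} (hC : 0 < C) (hp : 1 < p) (hq : q = p / (p - 1))
    (hF : 0 < F) (hs : 0 ≤ s) (hb : 0 ≤ b) :
    s * b ≤ C * s ^ p / F + 1 / q * (1 / (p * C)) ^ (q - 1) * b ^ q * F ^ (q - 1) := by
  have hp0 : 0 < p := by linarith
  have hp1 : 0 < p - 1 := by linarith
  have hpq : p.HolderConjugate q := by
    rw [hq]
    exact Real.HolderConjugate.conjExponent hp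
  have hpC : 0 < p * C := by positivity
  -- The two weights are mutually inverse, and the first makes the `p`-th power term equal to `C s ^
  -- p / F`.
  have h := Real.young_inequality_of_nonneg (a := s * (p * C / F) ^ (1 / p))
    (b := b * (F / (p * C)) ^ (1 / p)) (by positivity) (by positivity) hpq
  have e0 : (p * C / F) ^ (1 / p) * (F / (p * C)) ^ (1 / p) = 1 := by
    rw [← Real.mul_rpow (by positivity) (by positivity)]
    have : p * C / F * (F / (p * C)) = 1 := by field_simp
    rw [this, Real.one_rpow]
  have e1 : s * (p * C / F) ^ (1 / p) * (b * (F / (p * C)) ^ (1 / p)) = s * b := by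
    linear_combination s * b * e0
  have e2 : (s * (p * C / F) ^ (1 / p)) ^ p / p = C * s ^ p / F := by
    rw [Real.mul_rpow hs (by positivity), ← Real.rpow_mul (by positivity),
      one_div_mul_cancel hp0.ne', Real.rpow_one]
    field_simp
  have hq1 : 1 / p * q = q - 1 := by
    rw [hq]
    field_simp
    ring
  have e3 : (b * (F / (p * C)) ^ (1 / p)) ^ q / q =
      1 / q * (1 / (p * C)) ^ (q - 1) * b ^ q * F ^ (q - 1) := by
    rw [Real.mul_rpow hb (by positivity), ← Real.rpow_mul (by positivity), hq1,
      div_eq_mul_one_div F (p * C), Real.mul_rpow hF.le (by positivity)]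
    ring
  rw [e1, e2, e3] at h
  exact h

/-- The gradient estimate bounds all directional derivatives `∂ₜ f + ∇f · e`. -/
theorem ae_directional_le {d : ℕ} {Ω : Set (Space d)} (hΩ : IsOpen Ω) {T : ℝ}
    {f ft : Space d × ℝ → ℝ} {Df : Space d × ℝ → Space d} {a : ℝ → ℝ} {C p q r m ξ : ℝ}
    (hC : 0 < C) (hp : 1 < p) (hq : q = p / (p - 1)) (hm : m = r / (p - 1) - 1)
    (hξ : ξ = 1 / q * (1 / (p * C)) ^ (q - 1))
    (hf : ∀ z ∈ cylinder Ω T, 0 ≤ f z) (hfr : ∀ z ∈ cylinder Ω T, 0 < f z ^ r)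
    (H : ReversedGradientEstimate Ω T a C p r f ft Df) :
    ∀ᵐ z ∂(volume.restrict (cylinder Ω T)), ∀ e : Space d,
      ft z + inner ℝ (Df z) e ≤ - a z.2 * f z + ξ * ‖e‖ ^ q * f z ^ (m + 1) := by
  have hU : IsOpen (cylinder Ω T) := hΩ.prod isOpen_Ioo
  filter_upwards [H, ae_restrict_mem hU.measurableSet] with z hz hzU e
  have h1 := mul_le_young hC hp hq (hfr z hzU) (norm_nonneg (Df z)) (norm_nonneg e)
  -- Here `r (q - 1) = r / (p - 1) = m + 1`.
  have h2 : (f z ^ r) ^ (q - 1) = f z ^ (m + 1) := by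
    rw [← Real.rpow_mul (hf z hzU)]
    congr 1
    rw [hq, hm]
    have : p - 1 ≠ 0 := by linarith
    field_simp
    ring
  rw [h2, ← hξ] at h1
  have h3 := real_inner_le_norm (Df z) e
  linarith

/-- The Harnack estimate in terms of a primitive `G` of `y ↦ y ^ (-(m + 1))`. -/
theorem primitive_sub_le {d : ℕ} {Ω : Set (Space d)} (hΩ : IsOpen Ω) (hconv : Convex ℝ Ω) {T : ℝ}
    {f ft : Space d × ℝ → ℝ} {Df : Space d × ℝ → Space d} {a A : ℝ → ℝ} {p q m ξ : ℝ}
    (hp : 1 < p) (hq : q = p / (p - 1)) (hξ : 0 ≤ ξ)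
    (hcont : ContinuousOn f (cylinder Ω T)) (hF2 : ACOnC1Curves Ω T f)
    (hft : IsWeakTimeDeriv (cylinder Ω T) f ft) (hDf : IsWeakGradient (cylinder Ω T) f Df)
    (ha : LocallyIntegrableOn a (Ioo 0 T)) (hA : IsAntiderivative T a A)
    (hf0 : ∀ z ∈ cylinder Ω T, 0 ≤ f z)
    (hB : ContinuousOn (fun z => f z ^ (m + 1)) (cylinder Ω T))
    (H : ∀ᵐ z ∂(volume.restrict (cylinder Ω T)), ∀ e : Space d,
      ft z + inner ℝ (Df z) e ≤ - a z.2 * f z + ξ * ‖e‖ ^ q * f z ^ (m + 1))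
    {G : ℝ → ℝ} {S : Set ℝ} (hSo : IsOpen S) (hG : ContDiffOn ℝ 1 G S)
    (hGd : ∀ y ∈ S, deriv G y = y ^ (-(m + 1))) (hG0 : ∀ y ∈ S, 0 ≤ deriv G y)
    (hfS : ∀ z ∈ cylinder Ω T, ∀ c : ℝ, 0 < c → c * f z ∈ S)
    {x₁ x₂ : Space d} (hx₁ : x₁ ∈ Ω) (hx₂ : x₂ ∈ Ω) {t₁ t₂ : ℝ} (h1 : 0 < t₁) (h12 : t₁ < t₂)
    (h2 : t₂ < T) :
    0 < (∫ t in t₁..t₂, Real.exp (m * (p - 1) * A t)) ∧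
    G (Real.exp (A t₂) * f (x₂, t₂)) - G (Real.exp (A t₁) * f (x₁, t₁)) ≤
      ξ * ‖x₂ - x₁‖ ^ q * (∫ t in t₁..t₂, Real.exp (m * (p - 1) * A t)) ^ (1 - q) := by
  have hp1 : 0 < p - 1 := by linarith
  have hq0 : 0 < q := by rw [hq]; positivity
  have hIcc : Icc t₁ t₂ ⊆ Ioo 0 T := fun t ht => ⟨h1.trans_le ht.1, ht.2.trans_lt h2⟩
  have hai : IntervalIntegrable a volume t₁ t₂ := by
    rw [intervalIntegrable_iff_integrableOn_Icc_of_le h12.le]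
    exact ha.integrableOn_compact_subset hIcc isCompact_Icc
  have hAt : ∀ t ∈ Icc t₁ t₂, A t - A t₁ = ∫ τ in t₁..t, a τ := fun t ht =>
    hA t₁ (hIcc ⟨le_rfl, h12.le⟩) t (hIcc ht)
  have hAc : ContinuousOn A (Icc t₁ t₂) := by
    have h0 := (hai.absolutelyContinuousOnInterval_intervalIntegral
      (left_mem_uIcc (b := t₂))).continuousOn
    rw [uIcc_of_le h12.le] at h0
    refine (h0.const_add (A t₁)).congr fun t ht => ?_
    linarith [hAt t ht]
  -- The optimal speed profile `e^(m(p-1)A)`, extended by constants outside `[t₁, t₂]` so that the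
  -- curve is `C¹` on the whole line.
  set w : ℝ → ℝ := fun t => Real.exp (m * (p - 1) * IccExtend h12.le ((Icc t₁ t₂).domRestrict A) t)
    with hw
  have hwc : Continuous w := by
    have : Continuous (IccExtend h12.le ((Icc t₁ t₂).domRestrict A)) :=
      hAc.domRestrict.Icc_extend'
    fun_prop
  have hw0 : ∀ t, 0 < w t := fun t => Real.exp_pos _
  have hwA : ∀ t ∈ Icc t₁ t₂, w t = Real.exp (m * (p - 1) * A t) := fun t ht => by
    simp only [hw, IccExtend_of_mem _ _ ht]
    rfl
  have hI : (∫ t in t₁..t₂, Real.exp (m * (p - 1) * A t)) = ∫ t in t₁..t₂, w t := by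
    refine intervalIntegral.integral_congr fun t ht => ?_
    rw [uIcc_of_le h12.le] at ht
    exact (hwA t ht).symm
  rw [hI]
  set I := ∫ t in t₁..t₂, w t with hIdef
  have hIpos : 0 < I :=
    intervalIntegral.intervalIntegral_pos_of_pos (hwc.intervalIntegrable _ _) hw0 h12
  refine ⟨hIpos, ?_⟩
  set x : ℝ → Space d := fun t => x₁ + ((∫ τ in t₁..t, w τ) / I) • (x₂ - x₁) with hx
  set x' : ℝ → Space d := fun t => (w t / I) • (x₂ - x₁) with hx'
  have hxd : ∀ t, HasDerivAt x (x' t) t := fun t =>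
    (((intervalIntegral.integral_hasDerivAt_right (hwc.intervalIntegrable _ _)
      (hwc.stronglyMeasurableAtFilter _ _) hwc.continuousAt).div_const I).smul_const
        (x₂ - x₁)).const_add x₁
  have hx'c : Continuous x' := by fun_prop
  have hxC : ContDiff ℝ 1 x := by
    rw [contDiff_one_iff_deriv]
    refine ⟨fun t => (hxd t).differentiableAt, ?_⟩
    rwa [show deriv x = x' from funext fun t => (hxd t).deriv]
  have hxΩ : MapsTo x (Icc t₁ t₂) Ω := by
    intro t ht
    refine hconv.add_smul_sub_mem hx₁ hx₂ ⟨?_, ?_⟩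
    · exact div_nonneg (intervalIntegral.integral_nonneg ht.1 fun s _ => (hw0 s).le) hIpos.le
    · rw [div_le_one hIpos]
      exact intervalIntegral.integral_mono_interval le_rfl ht.1 ht.2
        (Filter.Eventually.of_forall fun s => (hw0 s).le) (hwc.intervalIntegrable _ _)
  have hxt₁ : x t₁ = x₁ := by simp [hx]
  have hxt₂ : x t₂ = x₂ := by
    simp only [hx]
    rw [← hIdef, div_self hIpos.ne']
    simp
  have hmem : ∀ t ∈ Icc t₁ t₂, (x t, t) ∈ cylinder Ω T := fun t ht => ⟨hxΩ ht, hIcc ht⟩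
  have hzc : Continuous fun t => (x t, t) := hxC.continuous.prodMk continuous_id
  set k : ℝ → ℝ := fun t => ξ * ‖x' t‖ ^ q with hk
  have hkc : Continuous k := continuous_const.mul
    (hx'c.norm.rpow_const fun _ => Or.inr hq0.le)
  have hkB : ContinuousOn (fun t => k t * f (x t, t) ^ (m + 1)) (uIcc t₁ t₂) := by
    rw [uIcc_of_le h12.le]
    exact hkc.continuousOn.mul (hB.comp hzc.continuousOn hmem)
  have main := sub_le_integral_of_linear_differential_ineq (u := fun t => f (x t, t)) (a := a)
    (A := A) (κ := fun t => k t * f (x t, t) ^ (m + 1)) (S := S) (G := G)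
    (l := fun t => ξ * ‖x₂ - x₁‖ ^ q * I ^ (-q) * w t) h12.le
    (hF2 t₁ t₂ x h1 h12 h2 hxC.contDiffOn hxΩ) hai hAt hkB.intervalIntegrable ?_ hSo hG ?_ hG0
    ((continuous_const.mul hwc).intervalIntegrable _ _) ?_
  · simp only [hxt₁, hxt₂] at main
    refine main.trans_eq ?_
    rw [intervalIntegral.integral_const_mul, ← hIdef, sub_eq_neg_add 1 q, Real.rpow_add hIpos,
      Real.rpow_one]
    ring
  · intro s hs t ht hst
    refine sub_le_integral_along_curve (B := fun z => f z ^ (m + 1)) hΩ hcont hB hft hDf ha hkc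
      hxd (h1.trans_le hs.1) hst (ht.2.trans_lt h2)
      (hxΩ.mono_left (Icc_subset_Icc hs.1 ht.2)) ?_
    filter_upwards [H] with z hz τ
    exact hz (x' τ)
  · intro t ht
    exact hfS _ (hmem t ht) _ (Real.exp_pos _)
  · intro t ht
    have hu0 : 0 ≤ f (x t, t) := hf0 _ (hmem t ht)
    rw [hGd _ (hfS _ (hmem t ht) _ (Real.exp_pos _)),
      Real.mul_rpow (Real.exp_pos _).le hu0, hk]
    have e1 : ‖x' t‖ ^ q = Real.exp (m * p * A t) * I ^ (-q) * ‖x₂ - x₁‖ ^ q := by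
      simp only [hx']
      rw [norm_smul, Real.norm_of_nonneg (div_pos (hw0 t) hIpos).le,
        Real.mul_rpow (div_pos (hw0 t) hIpos).le (norm_nonneg _),
        Real.div_rpow (hw0 t).le hIpos.le, hwA t ht, ← Real.exp_mul, Real.rpow_neg hIpos.le,
        div_eq_mul_inv]
      have : m * (p - 1) * A t * q = m * p * A t := by
        rw [hq]
        field_simp
      rw [this]
    -- Only an inequality: if `f` vanishes and `m + 1 ≠ 0`, the product is `0`, not `1`.
    have e2 : f (x t, t) ^ (-(m + 1)) * f (x t, t) ^ (m + 1) ≤ 1 := by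
      rw [Real.rpow_neg hu0]
      exact inv_mul_le_one
    -- The exponents add up to `-(m+1) + 1 + mp = m(p-1)`; this is why the chosen speed turns the
    -- integrand into a constant multiple of `w`.
    have e3 : Real.exp (A t) ^ (-(m + 1)) * Real.exp (A t) * Real.exp (m * p * A t) = w t := by
      rw [hwA t ht, ← Real.exp_mul, ← Real.exp_add, ← Real.exp_add]
      congr 1
      ring
    have e4 : 0 ≤ ξ * ‖x₂ - x₁‖ ^ q * I ^ (-q) * w t :=
      mul_nonneg (by positivity) (hw0 t).le
    calc _ = (ξ * ‖x₂ - x₁‖ ^ q * I ^ (-q) * w t) *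
          (f (x t, t) ^ (-(m + 1)) * f (x t, t) ^ (m + 1)) := by
          simp only [e1]
          rw [← e3]
          ring
      _ ≤ _ := mul_le_of_le_one_right e4 e2

/-! ### Solving for the later value -/

theorem deriv_neg_rpow_div {m y : ℝ} (hm : m ≠ 0) (hy : 0 < y) :
    deriv (fun y : ℝ => - (y ^ (-m) / m)) y = y ^ (-(m + 1)) := by
  have h : HasDerivAt (fun y : ℝ => - (y ^ (-m) / m)) (-(-m * y ^ (-m - 1) / m)) y :=
    ((Real.hasDerivAt_rpow_const (p := -m) (Or.inl hy.ne')).div_const m).neg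
  rw [h.deriv]
  rw [show -(m + 1) = -m - 1 by ring]
  field_simp

/-- Solving the power-type estimate for `f₂` when `m > 0`. -/
theorem power_estimate_of_pos {m X A₁ A₂ f₁ f₂ : ℝ} (hm : 0 < m) (h1 : 0 < f₁) (h2 : 0 < f₂)
    (h : - ((Real.exp A₂ * f₂) ^ (-m) / m) - - ((Real.exp A₁ * f₁) ^ (-m) / m) ≤ X) :
    Real.exp (m * A₂) / Real.exp (m * A₁) * (f₁ ^ (-m) - m * X * Real.exp (m * A₁)) ≤ f₂ ^ (-m) ∧
    (0 < f₁ ^ (-m) - m * X * Real.exp (m * A₁) →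
      f₂ ≤ Real.exp A₁ / Real.exp A₂ * f₁ *
        (1 - m * X * f₁ ^ m * Real.exp (m * A₁)) ^ (-1 / m)) := by
  have hE : ∀ A : ℝ, Real.exp A ^ (-m) = (Real.exp (m * A))⁻¹ := fun A => by
    rw [← Real.exp_mul, ← Real.exp_neg]
    congr 1
    ring
  have first : Real.exp (m * A₂) / Real.exp (m * A₁) *
      (f₁ ^ (-m) - m * X * Real.exp (m * A₁)) ≤ f₂ ^ (-m) := by
    rw [Real.mul_rpow (Real.exp_pos _).le h2.le, Real.mul_rpow (Real.exp_pos _).le h1.le,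
      hE, hE] at h
    have hp1 := Real.exp_pos (m * A₁)
    have hp2 := Real.exp_pos (m * A₂)
    have h' : (Real.exp (m * A₁))⁻¹ * f₁ ^ (-m) - m * X ≤ (Real.exp (m * A₂))⁻¹ * f₂ ^ (-m) := by
      have h3 := mul_le_mul_of_nonneg_left h hm.le
      have h4 : m * (-((Real.exp (m * A₂))⁻¹ * f₂ ^ (-m) / m) -
          -((Real.exp (m * A₁))⁻¹ * f₁ ^ (-m) / m)) =
          (Real.exp (m * A₁))⁻¹ * f₁ ^ (-m) - (Real.exp (m * A₂))⁻¹ * f₂ ^ (-m) := by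
        field_simp
        ring
      linarith
    have h5 := mul_le_mul_of_nonneg_left h' hp2.le
    rw [mul_inv_cancel_left₀ hp2.ne'] at h5
    refine le_trans (le_of_eq ?_) h5
    field_simp
  refine ⟨first, fun hP => ?_⟩
  set P := f₁ ^ (-m) - m * X * Real.exp (m * A₁) with hPdef
  have hc : 0 < Real.exp (m * A₂) / Real.exp (m * A₁) := by positivity
  have hneg : -1 / m ≤ 0 := div_nonpos_of_nonpos_of_nonneg (by norm_num) hm.le
  have h6 := Real.rpow_le_rpow_of_nonpos (mul_pos hc hP) first hneg
  have hmm : -m * (-1 / m) = 1 := by field_simp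
  rw [← Real.rpow_mul h2.le, hmm, Real.rpow_one, Real.mul_rpow hc.le hP.le] at h6
  have e1 : (Real.exp (m * A₂) / Real.exp (m * A₁)) ^ (-1 / m) = Real.exp A₁ / Real.exp A₂ := by
    rw [← Real.exp_sub, ← Real.exp_sub, ← Real.exp_mul]
    congr 1
    field_simp
    ring
  -- Pulling out `f₁ ^ (-m)` lets the power `-1 / m` return a plain factor `f₁`.
  have hR : P = f₁ ^ (-m) * (1 - m * X * f₁ ^ m * Real.exp (m * A₁)) := by
    have : f₁ ^ (-m) * f₁ ^ m = 1 := by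
      rw [← Real.rpow_add h1]
      simp
    rw [hPdef]
    linear_combination (m * X * Real.exp (m * A₁)) * this
  have hRpos : 0 < 1 - m * X * f₁ ^ m * Real.exp (m * A₁) := by
    rw [hR] at hP
    exact (mul_pos_iff_of_pos_left (Real.rpow_pos_of_pos h1 _)).1 hP
  rw [e1, hR, Real.mul_rpow (Real.rpow_nonneg h1.le _) hRpos.le, ← Real.rpow_mul h1.le, hmm,
    Real.rpow_one, ← mul_assoc] at h6
  exact h6

/-- Solving the power-type estimate for `f₂` when the exponent `n = -m` is positive. -/
theorem power_estimate_of_neg {n X A₁ A₂ f₁ f₂ : ℝ} (hn : 0 < n) (hX : 0 ≤ X) (h1 : 0 < f₁)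
    (h2 : 0 < f₂)
    (h : (Real.exp A₂ * f₂) ^ n / n - (Real.exp A₁ * f₁) ^ n / n ≤ X) :
    f₂ ≤ Real.exp A₁ / Real.exp A₂ * f₁ *
      (1 + n * X / (f₁ ^ n * Real.exp (n * A₁))) ^ (1 / n) := by
  have hpos1 : 0 < Real.exp A₁ * f₁ := by positivity
  have hpos2 : 0 < Real.exp A₂ * f₂ := by positivity
  have hD : (Real.exp A₁ * f₁) ^ n = f₁ ^ n * Real.exp (n * A₁) := by
    rw [Real.mul_rpow (Real.exp_pos _).le h1.le, ← Real.exp_mul, mul_comm A₁ n]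
    ring
  have hDpos : 0 < f₁ ^ n * Real.exp (n * A₁) := by positivity
  have h3 : (Real.exp A₂ * f₂) ^ n ≤
      (Real.exp A₁ * f₁) ^ n * (1 + n * X / (f₁ ^ n * Real.exp (n * A₁))) := by
    rw [hD, mul_add, mul_one, mul_div_cancel₀ _ hDpos.ne', ← hD]
    have h4 := mul_le_mul_of_nonneg_left h hn.le
    rw [mul_sub, mul_div_cancel₀ _ hn.ne', mul_div_cancel₀ _ hn.ne'] at h4
    linarith
  have h5 := Real.rpow_le_rpow (by positivity) h3 (one_div_pos.2 hn).le
  have hn1 : n * (1 / n) = 1 := mul_one_div_cancel hn.ne'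
  rw [Real.mul_rpow (Real.rpow_nonneg hpos1.le n) (by positivity), ← Real.rpow_mul hpos2.le,
    ← Real.rpow_mul hpos1.le, hn1, Real.rpow_one, Real.rpow_one] at h5
  rw [div_mul_eq_mul_div, div_mul_eq_mul_div, le_div_iff₀ (Real.exp_pos _)]
  linarith

end Harnack

/-! ### The Harnack inequalities -/

theorem theorem3p2 {d : ℕ} (Ω : Set (Harnack.Space d)) (hΩ : IsOpen Ω) (hconv : Convex ℝ Ω)
    (T : ℝ) (f ft : Harnack.Space d × ℝ → ℝ) (Df : Harnack.Space d × ℝ → Harnack.Space d)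
    (a A : ℝ → ℝ) (C p : ℝ) (hC : 0 < C) (hp : 1 < p)
    (hW : Harnack.MemW11loc (Harnack.cylinder Ω T) f)
    (hcont : ContinuousOn f (Harnack.cylinder Ω T))
    (hF2 : Harnack.ACOnC1Curves Ω T f)
    (hF3 : Harnack.DiffOffNullOnACCurves Ω T f)
    (hft : Harnack.IsWeakTimeDeriv (Harnack.cylinder Ω T) f ft)
    (hDf : Harnack.IsWeakGradient (Harnack.cylinder Ω T) f Df)
    (ha : MeasureTheory.LocallyIntegrableOn a (Set.Ioo 0 T))
    (hA : Harnack.IsAntiderivative T a A) :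
    (∀ r : ℝ, (∀ z ∈ Harnack.cylinder Ω T, 0 < f z) →
      Harnack.ReversedGradientEstimate Ω T a C p r f ft Df →
      ∀ x₁ ∈ Ω, ∀ x₂ ∈ Ω, ∀ t₁ t₂ : ℝ, 0 < t₁ → t₁ < t₂ → t₂ < T →
      ∀ q m ξ I : ℝ, q = p / (p - 1) → m = r / (p - 1) - 1 →
        ξ = 1 / q * (1 / (p * C)) ^ (q - 1) →
        I = ∫ t in t₁..t₂, Real.exp (m * (p - 1) * A t) →
        (r = p - 1 →
          f (x₂, t₂) ≤ Real.exp (A t₁) / Real.exp (A t₂) * f (x₁, t₁) *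
            Real.exp (ξ * ‖x₂ - x₁‖ ^ q / (t₂ - t₁) ^ (q - 1))) ∧
        (p - 1 < r →
          f (x₂, t₂) ^ (-m) ≥ Real.exp (m * A t₂) / Real.exp (m * A t₁) *
            (f (x₁, t₁) ^ (-m) - m * ξ * ‖x₂ - x₁‖ ^ q * I ^ (1 - q) * Real.exp (m * A t₁)) ∧
          (0 < f (x₁, t₁) ^ (-m) - m * ξ * ‖x₂ - x₁‖ ^ q * I ^ (1 - q) * Real.exp (m * A t₁) →
            f (x₂, t₂) ≤ Real.exp (A t₁) / Real.exp (A t₂) * f (x₁, t₁) *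
              (1 - m * ξ * ‖x₂ - x₁‖ ^ q * I ^ (1 - q) * f (x₁, t₁) ^ m *
                Real.exp (m * A t₁)) ^ (-1 / m))) ∧
        (r < p - 1 →
          f (x₂, t₂) ≤ Real.exp (A t₁) / Real.exp (A t₂) * f (x₁, t₁) *
            (1 + |m| * ξ * ‖x₂ - x₁‖ ^ q * I ^ (1 - q) /
              (f (x₁, t₁) ^ |m| * Real.exp (|m| * A t₁))) ^ (1 / |m|))) ∧
    ((∀ z ∈ Harnack.cylinder Ω T, 0 ≤ f z) →
      Harnack.ReversedGradientEstimate Ω T a C p 0 f ft Df →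
      ∀ x₁ ∈ Ω, ∀ x₂ ∈ Ω, ∀ t₁ t₂ : ℝ, 0 < t₁ → t₁ < t₂ → t₂ < T →
      ∀ q m ξ I : ℝ, q = p / (p - 1) → m = -1 →
        ξ = 1 / q * (1 / (p * C)) ^ (q - 1) →
        I = ∫ t in t₁..t₂, Real.exp (m * (p - 1) * A t) →
        f (x₂, t₂) ^ |m| ≤ (Real.exp (A t₁) / Real.exp (A t₂)) ^ |m| *
          (f (x₁, t₁) ^ |m| + |m| * ξ * ‖x₂ - x₁‖ ^ q * I ^ (1 - q) /
            Real.exp (|m| * A t₁))) := by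
  have hp1 : 0 < p - 1 := by linarith
  refine ⟨?_, ?_⟩
  · intro r hpos hest x₁ hx₁ x₂ hx₂ t₁ t₂ h1 h12 h2 q m ξ I hq hm hξ hI
    have hq0 : 0 < q := by rw [hq]; positivity
    have hξ0 : 0 ≤ ξ := by rw [hξ]; positivity
    have hdir := Harnack.ae_directional_le hΩ hC hp hq hm hξ (fun z hz => (hpos z hz).le)
      (fun z hz => Real.rpow_pos_of_pos (hpos z hz) r) hest
    have hB : ContinuousOn (fun z => f z ^ (m + 1)) (Harnack.cylinder Ω T) :=
      hcont.rpow_const fun z hz => Or.inl (hpos z hz).ne'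
    have hf₁ : 0 < f (x₁, t₁) := hpos _ ⟨hx₁, h1, h12.trans h2⟩
    have hf₂ : 0 < f (x₂, t₂) := hpos _ ⟨hx₂, h1.trans h12, h2⟩
    have hS : ∀ z ∈ Harnack.cylinder Ω T, ∀ c : ℝ, 0 < c → c * f z ∈ Set.Ioi (0 : ℝ) :=
      fun z hz c hc => mul_pos hc (hpos z hz)
    -- A single primitive `-y^(-m)/m` is increasing on `y > 0` for either sign of `m`, so it serves
    -- both `r > p - 1` and `r < p - 1`.
    have power : m ≠ 0 → 0 < I ∧
        - ((Real.exp (A t₂) * f (x₂, t₂)) ^ (-m) / m) -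
          - ((Real.exp (A t₁) * f (x₁, t₁)) ^ (-m) / m) ≤ ξ * ‖x₂ - x₁‖ ^ q * I ^ (1 - q) := by
      intro hm0
      rw [hI]
      refine Harnack.primitive_sub_le (G := fun y : ℝ => - (y ^ (-m) / m)) hΩ hconv hp hq hξ0
        hcont hF2 hft hDf ha hA (fun z hz => (hpos z hz).le) hB hdir isOpen_Ioi ?_
        (fun y hy => Harnack.deriv_neg_rpow_div hm0 hy) (fun y hy => ?_) hS hx₁ hx₂ h1 h12 h2
      · intro y hy
        exact (((Real.contDiffAt_rpow_const_of_ne (ne_of_gt hy)).div_const m).neg).contDiffWithinAt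
      · rw [Harnack.deriv_neg_rpow_div hm0 hy]
        exact Real.rpow_nonneg (le_of_lt hy) _
    refine ⟨fun hr => ?_, fun hr => ?_, fun hr => ?_⟩
    · have hm0 : m = 0 := by rw [hm, hr, div_self hp1.ne', sub_self]
      have key := (Harnack.primitive_sub_le (G := Real.log) hΩ hconv hp hq hξ0
        hcont hF2 hft hDf ha hA (fun z hz => (hpos z hz).le) hB hdir isOpen_Ioi
        (fun y hy => (Real.contDiffAt_log.2 (ne_of_gt hy)).contDiffWithinAt)
        (fun y hy => by rw [Real.deriv_log, hm0, zero_add, Real.rpow_neg_one])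
        (fun y hy => by rw [Real.deriv_log]; exact inv_nonneg.2 (le_of_lt hy))
        hS hx₁ hx₂ h1 h12 h2).2
      have hI' : (∫ t in t₁..t₂, Real.exp (m * (p - 1) * A t)) = t₂ - t₁ := by simp [hm0]
      rw [hI', Real.log_mul (Real.exp_pos _).ne' hf₂.ne', Real.log_mul (Real.exp_pos _).ne' hf₁.ne',
        Real.log_exp, Real.log_exp, show 1 - q = -(q - 1) by ring,
        Real.rpow_neg (sub_pos.2 h12).le, ← div_eq_mul_inv] at key
      rw [← Real.exp_sub]
      nth_rewrite 1 [← Real.exp_log hf₁]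
      rw [← Real.exp_add, ← Real.exp_add, ← Real.log_le_iff_le_exp hf₂]
      linarith
    · have hm0 : 0 < m := by
        rw [hm, sub_pos, lt_div_iff₀ hp1]
        linarith
      have key := Harnack.power_estimate_of_pos hm0 hf₁ hf₂ (power hm0.ne').2
      simpa only [← mul_assoc] using key
    · have hm0 : m < 0 := by
        rw [hm, sub_neg, div_lt_iff₀ hp1]
        linarith
      obtain ⟨hI0, hpw⟩ := power hm0.ne
      rw [abs_of_neg hm0]
      have key := Harnack.power_estimate_of_neg (n := -m) (neg_pos.2 hm0)
        (X := ξ * ‖x₂ - x₁‖ ^ q * I ^ (1 - q)) (by positivity) hf₁ hf₂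
        (by simpa only [div_neg] using hpw)
      simpa only [← mul_assoc] using key
  · intro hnn hest x₁ hx₁ x₂ hx₂ t₁ t₂ h1 h12 h2 q m ξ I hq hm hξ hI
    have hq0 : 0 < q := by rw [hq]; positivity
    have hξ0 : 0 ≤ ξ := by rw [hξ]; positivity
    have hm1 : m + 1 = 0 := by rw [hm]; norm_num
    -- With `r = 0` and `m + 1 = 0` all powers of `f` have exponent `0` and equal `1` even where `f
    -- = 0`, so nonnegativity suffices and `G` can be the identity on all of `ℝ`.
    have hdir := Harnack.ae_directional_le (m := m) hΩ hC hp hq (by rw [hm]; simp) hξ hnn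
      (fun z _ => by rw [Real.rpow_zero]; exact one_pos) hest
    have key := (Harnack.primitive_sub_le (G := fun y => y) (S := Set.univ) hΩ hconv hp hq hξ0
      hcont hF2 hft hDf ha hA hnn (by simpa only [hm1, Real.rpow_zero] using continuousOn_const)
      hdir isOpen_univ contDiff_id.contDiffOn
      (fun y _ => by rw [hm1, neg_zero, Real.rpow_zero, deriv_id''])
      (fun y _ => by rw [deriv_id'']; exact zero_le_one)
      (fun _ _ _ _ => Set.mem_univ _) hx₁ hx₂ h1 h12 h2).2
    rw [← hI] at key
    have habs : |m| = 1 := by rw [hm]; norm_num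
    simp only [habs, Real.rpow_one, one_mul]
    rw [div_mul_eq_mul_div, le_div_iff₀ (Real.exp_pos _), mul_add,
      mul_div_cancel₀ _ (Real.exp_pos _).ne']
    linarith
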